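/- Let $r,n$ be positive integers with $2\le r\le n-2$. Identify $\mathbb F_{2^n}$ with $\mathbb F_2^n$ by any $\mathbb F_2$-linear isomorphism, and let $F:\mathbb F_2^n\to\mathbb F_2^n$ be the power function $F(x)=x^{2^{n-r}-1}$ of $\mathbb F_{2^n}$. Let $\mathrm{RM}(r,n)=\{(f(a))_{a\in\mathbb F_2^n} : f\in\mathbb F_2[x_1,\dots,x_n],\ \deg f\le r\}\subseteq\mathbb F_2^{2^n}$ be the binary Reed–Muller code, let $H$ be a parity-check matrix of $\mathrm{RM}(r,n)$ (that is, $\mathrm{RM}(r,n)=\{c : Hc=0\}$), and let $\mathcal C_F$ be the binary linear code of length $2^n$ with parity-check matrix $$\begin{bmatrix} H\\ F(x)\end{bmatrix}_{x\in\mathbb F_2^n},$$ where the column indexed by $x$ contains below the column of $H$ at $x$ the vector $F(x)\in\mathbb F_2^n$. Then $\mathcal C_F\subseteq \mathrm{RM}(r,n)$, $\dim \mathcal C_F=\dim \mathrm{RM}(r,n)-n$ (that is, $\mathcal C_F$ has codimension $n$ in $\mathrm{RM}(r,n)$), and $\mathcal C_F$ has minimum distance $3\cdot 2^{n-r-1}$.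 In particular, $\mathcal C_F$ contains no minimum-weight codeword of $\mathrm{RM}(r,n)$ (that is, no nonzero codeword of smallest Hamming weight among the nonzero codewords of $\mathrm{RM}(r,n)$). -/

import Mathlib

/-- The points of the vector space `𝔽₂ⁿ`; they index the coordinates of codewords of length `2ⁿ`. -/
abbrev F2Vec (n : ℕ) : Type := Fin n → ZMod 2

/-- The ambient space `𝔽₂^(2ⁿ)` of binary words of length `2ⁿ`, with coordinates indexed by `𝔽₂ⁿ`. -/
abbrev F2Word (n : ℕ) : Type := F2Vec n → ZMod 2

/-- The binary Reed-Muller code `RM(r, n)`: the space of evaluation vectors `(f(a))_{a ∈ 𝔽₂ⁿ}` of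
the polynomials `f ∈ 𝔽₂[x₁, …, xₙ]` of total degree at most `r`. -/
noncomputable def reedMuller (r n : ℕ) : Submodule (ZMod 2) (F2Word n) :=
  (MvPolynomial.restrictTotalDegree (Fin n) (ZMod 2) r).map
    (MvPolynomial.evalₗ (ZMod 2) (Fin n))

/-- The linear code `{c : P c = 0}` of length `2ⁿ` with parity-check matrix `P`. -/
def codeOfParityCheck {n : ℕ} {ι : Type*} (P : Matrix ι (F2Vec n) (ZMod 2)) :
    Submodule (ZMod 2) (F2Word n) :=
  LinearMap.ker P.mulVecLin

/-- The `m × 2ⁿ` matrix `M_F = [F(x)]_{x ∈ 𝔽₂ⁿ}` whose column at `x` is the vector `F(x) ∈ 𝔽₂ᵐ`. -/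
def valueMatrix {n m : ℕ} (F : F2Vec n → F2Vec m) : Matrix (Fin m) (F2Vec n) (ZMod 2) :=
  Matrix.of fun i x => F x i

/-- The code `C_F` whose parity-check matrix is `H` stacked on top of `M_F`. -/
def subcodeOfFunction {n m : ℕ} {ι : Type*} (H : Matrix ι (F2Vec n) (ZMod 2))
    (F : F2Vec n → F2Vec m) : Submodule (ZMod 2) (F2Word n) :=
  codeOfParityCheck (Matrix.fromRows H (valueMatrix F))

/-- The power function `x ↦ x ^ d` of a field `K ≅ 𝔽_{2ⁿ}`, read as a function `𝔽₂ⁿ → 𝔽₂ⁿ` through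
an `𝔽₂`-linear identification `φ` of `𝔽₂ⁿ` with `K`. -/
def powerFunction {n : ℕ} {K : Type*} [Field K] [Algebra (ZMod 2) K]
    (φ : F2Vec n ≃ₗ[ZMod 2] K) (d : ℕ) : F2Vec n → F2Vec n :=
  fun x => φ.symm (φ x ^ d)

/-- `d` is the minimum distance of the code `C`: the least Hamming distance between two distinct
codewords (in particular, there are two distinct codewords). -/
def HasMinDistance {n : ℕ} (C : Submodule (ZMod 2) (F2Word n)) (d : ℕ) : Prop :=
  IsLeast {k : ℕ | ∃ c ∈ C, ∃ c' ∈ C, c ≠ c' ∧ hammingDist c c' = k} d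

/-- `c` is a minimum-weight codeword of `C`: a nonzero codeword whose Hamming weight is smallest
among all nonzero codewords of `C`. -/
def IsMinWeightCodeword {n : ℕ} (C : Submodule (ZMod 2) (F2Word n)) (c : F2Word n) : Prop :=
  c ∈ C ∧ c ≠ 0 ∧ ∀ c' ∈ C, c' ≠ 0 → hammingNorm c ≤ hammingNorm c'

/-!
Write `s = n - r` and `d = 2 ^ s - 1`. Through the identification `φ` of `𝔽₂ⁿ` with the field `K`,
the subcode consists of the words `c` of `RM(r, n)` whose syndrome `∑ c(x) x ^ d` in `K` is zero
(`subcodeOfFunction_powerFunction_eq`). Three facts carry the proof.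

* A flat `A` of size `2 ^ s` in `K` has `∑ x ∈ A, x ^ d = ∏ v, v`, the product over the nonzero
  elements of its direction (`IsFlat.sum_pow_card_sub_one`), by Lagrange interpolation of `X ^ d` on
  `A`. So the indicator of such a flat never has syndrome zero. Moreover, the syndromes of the
  indicators of the multiples `x V` of one subspace `V` are the `x ^ d * M` with a fixed `M ≠ 0`, and
  they span `K` (`eq_top_of_pow_mem`); hence the syndrome is onto, and the codimension is `n`.

* A nonzero word of `RM(r, n)` of weight less than `3 * 2 ^ (s - 1)` is the indicator of a flat of
  size `2 ^ s` (`DegreeLT.isFlat_wordSupport`). This is the beginning of the Kasami-Tokura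
  classification, proved by induction on `n` through the slices `x₁ = 0` and `x₁ = 1`. Together with
  the first fact it bounds the minimum distance from below and excludes the minimum-weight words.

* The bound is attained by a sum of the indicators of two subspaces of dimension `s` that meet in a
  subspace `U` of dimension `s - 2` and have the same product of nonzero elements. Under the
  additive function `x ↦ ∏ u ∈ U, (x - u)` this condition becomes `a b (a + b) = c d (c + d)` for
  planes spanned by `a, b` and by `c, d`, which has solutions by a dimension count
  (`exists_planes_prod_eq`). Every subspace of `K` is the range of such a function
  (`exists_range_vanishingMap_eq`), so `U` can be found once the planes are chosen.
-/

/-! ### Boolean functions of bounded degree -/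

/-- `DegreeLT k f` says that the Boolean function `f` has algebraic degree less than `k`, expressed
without coordinates: every `k`-fold iterated difference of `f` vanishes. -/
def DegreeLT {V : Type*} [AddCommGroup V] : ℕ → (V → ZMod 2) → Prop
  | 0, f => ∀ x, f x = 0
  | k + 1, f => ∀ a, DegreeLT k fun x => f (x + a) + f x

namespace DegreeLT

variable {V W : Type*} [AddCommGroup V] [AddCommGroup W]

theorem of_forall_eq_zero {f : V → ZMod 2} (hf : ∀ x, f x = 0) (k : ℕ) : DegreeLT k f := by
  induction k generalizing f with
  | zero => exact hf
  | succ k ih => exact fun a => ih fun x => by simp [hf]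

theorem add {k : ℕ} {f g : V → ZMod 2} (hf : DegreeLT k f) (hg : DegreeLT k g) :
    DegreeLT k fun x => f x + g x := by
  induction k generalizing f g with
  | zero => exact fun x => by simp [hf x, hg x]
  | succ k ih =>
    intro a
    have h := ih (hf a) (hg a)
    convert h using 2
    ring

theorem const_mul {k : ℕ} {f : V → ZMod 2} (hf : DegreeLT k f) (c : ZMod 2) :
    DegreeLT k fun x => c * f x := by
  induction k generalizing f with
  | zero => exact fun x => by simp [hf x]
  | succ k ih =>
    intro a
    have h := ih (hf a)
    convert h using 2
    ring

theorem succ {k : ℕ} {f : V → ZMod 2} (hf : DegreeLT k f) : DegreeLT (k + 1) f := by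
  induction k generalizing f with
  | zero => exact fun a x => by simp [hf x, hf (x + a)]
  | succ k ih => exact fun a => ih (hf a)

theorem mono {k l : ℕ} (hkl : k ≤ l) {f : V → ZMod 2} (hf : DegreeLT k f) : DegreeLT l f := by
  induction hkl with
  | refl => exact hf
  | step _ ih => exact ih.succ

theorem comp_add_right {k : ℕ} {f : V → ZMod 2} (hf : DegreeLT k f) (b : V) :
    DegreeLT k fun x => f (x + b) := by
  induction k generalizing f with
  | zero => exact fun x => hf _
  | succ k ih =>
    intro a
    have h := ih (hf a)
    convert h using 3
    rw [add_right_comm]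

theorem comp_hom {k : ℕ} {f : V → ZMod 2} (hf : DegreeLT k f) (L : W →+ V) :
    DegreeLT k fun x => f (L x) := by
  induction k generalizing f with
  | zero => exact fun x => hf _
  | succ k ih =>
    intro a
    have h := ih (hf (L a))
    convert h using 3
    exact congrArg f (map_add L _ _)

theorem mul_linear {k : ℕ} {f : V → ZMod 2} (hf : DegreeLT k f) (l : V →+ ZMod 2) :
    DegreeLT (k + 1) fun x => l x * f x := by
  induction k generalizing f with
  | zero => exact of_forall_eq_zero (fun x => by simp [hf x]) _
  | succ k ih =>
    intro a
    -- the product rule `D_a (l f) = l (D_a f) + l(a) f(· + a)`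
    have h := (ih (hf a)).add ((hf.comp_add_right a).const_mul (l a))
    convert h using 2
    simp only [map_add]
    ring

theorem eq_const {f : V → ZMod 2} (hf : DegreeLT 1 f) (x : V) : f x = f 0 := by
  have h : f (0 + x) + f 0 = 0 := hf x 0
  rwa [zero_add, CharTwo.add_eq_zero] at h

end DegreeLT

theorem degreeLT_multiset_prod {n : ℕ} (m : Multiset (Fin n)) :
    DegreeLT (m.card + 1) fun x : F2Vec n => (m.map x).prod := by
  induction m using Multiset.induction_on with
  | empty => exact fun a x => by simp [CharTwo.add_self_eq_zero]
  | cons i m ih =>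
    simpa using ih.mul_linear (Pi.evalAddMonoidHom (fun _ : Fin n => ZMod 2) i)

theorem DegreeLT.of_mem_reedMuller {r n : ℕ} {c : F2Word n} (hc : c ∈ reedMuller r n) :
    DegreeLT (r + 1) c := by
  obtain ⟨p, hp, rfl⟩ := hc
  rw [SetLike.mem_coe, MvPolynomial.mem_restrictTotalDegree] at hp
  have key : ∀ m ∈ p.support, DegreeLT (r + 1) fun x : F2Vec n =>
      MvPolynomial.eval x (MvPolynomial.monomial m (p.coeff m)) := by
    intro m hm
    have hdeg : m.toMultiset.card ≤ r := by
      rw [Finsupp.card_toMultiset]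
      exact (MvPolynomial.le_totalDegree hm).trans hp
    convert ((degreeLT_multiset_prod m.toMultiset).mono
      (Nat.succ_le_succ hdeg)).const_mul (p.coeff m) using 2 with x
    rw [MvPolynomial.eval_monomial, Finset.prod_multiset_map_count, Finsupp.toFinset_toMultiset]
    simp only [Finsupp.count_toMultiset]
    rfl
  have hsum : ∀ s ⊆ p.support, DegreeLT (r + 1) fun x : F2Vec n =>
      ∑ m ∈ s, MvPolynomial.eval x (MvPolynomial.monomial m (p.coeff m)) := by
    intro s
    induction s using Finset.induction_on with
    | empty => exact fun _ => of_forall_eq_zero (fun x => by simp) _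
    | insert m s hm ih =>
      intro hs
      rw [Finset.insert_subset_iff] at hs
      simpa only [Finset.sum_insert hm] using (key m hs.1).add (ih hs.2)
  convert hsum p.support subset_rfl using 1
  funext x
  rw [← map_sum, ← MvPolynomial.as_sum]
  rfl

/-! ### Flats -/

/-- A finite set `A` in a vector space over `𝔽₂` is a flat when it is closed under sums of three
elements. Over `𝔽₂` the nonempty such sets are exactly the affine subspaces; the empty set is
admitted. -/
def IsFlat {V : Type*} [AddCommGroup V] (A : Finset V) : Prop :=
  ∀ ⦃x⦄, x ∈ A → ∀ ⦃y⦄, y ∈ A → ∀ ⦃z⦄, z ∈ A → x + y + z ∈ A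

section ParallelFlats

variable {V : Type*} [AddCommGroup V] {A B : Finset V}

/-- Two finite sets are parallel flats when they are closed under those sums of three elements that
keep the parity of the number of summands from each; this makes `{0} × A ∪ {1} × B` a flat. -/
def ParallelFlats (A B : Finset V) : Prop :=
  IsFlat A ∧ IsFlat B ∧ (∀ x ∈ A, ∀ y ∈ B, ∀ z ∈ B, x + y + z ∈ A) ∧
    ∀ x ∈ B, ∀ y ∈ A, ∀ z ∈ A, x + y + z ∈ B

theorem ParallelFlats.symm (h : ParallelFlats A B) : ParallelFlats B A :=
  ⟨h.2.1, h.1, h.2.2.2, h.2.2.1⟩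

theorem IsFlat.parallel_self (h : IsFlat A) : ParallelFlats A A :=
  ⟨h, h, fun _ hx _ hy _ hz => h hx hy hz, fun _ hx _ hy _ hz => h hx hy hz⟩

theorem IsFlat.parallel_empty (h : IsFlat A) : ParallelFlats A ∅ :=
  ⟨h, by simp [IsFlat], by simp, by simp⟩

end ParallelFlats

theorem card_symmDiff_add {α : Type*} [DecidableEq α] (A B : Finset α) :
    (symmDiff A B).card + 2 * (A ∩ B).card = A.card + B.card := by
  have h1 : (symmDiff A B).card = (A \ B).card + (B \ A).card := by
    rw [symmDiff_def, Finset.sup_eq_union, Finset.card_union_of_disjoint]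
    exact disjoint_sdiff_sdiff
  have h2 := Finset.card_inter_add_card_sdiff A B
  have h3 := Finset.card_inter_add_card_sdiff B A
  rw [Finset.inter_comm] at h3
  omega

section Flats

variable {V : Type*} [AddCommGroup V] [Module (ZMod 2) V] [DecidableEq V] {A B : Finset V}

/-- A flat that contains more than half of another one contains all of it. -/
theorem IsFlat.subset_of_card_lt (hA : IsFlat A) (hB : IsFlat B)
    (h : A.card < 2 * (A ∩ B).card) : A ⊆ B := by
  intro x hxA
  by_contra hxB
  obtain ⟨b, hb⟩ : (A ∩ B).Nonempty := Finset.card_pos.mp (by omega)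
  rw [Finset.mem_inter] at hb
  -- translation by `b + x` moves `A ∩ B` into the rest of `A`
  have hle : (A ∩ B).card ≤ (A \ B).card := by
    refine Finset.card_le_card_of_injOn (fun w => w + b + x) (fun w hw => ?_)
      (fun w _ w' _ h => by simpa using h)
    rw [Finset.mem_coe, Finset.mem_inter] at hw
    rw [Finset.mem_coe, Finset.mem_sdiff]
    refine ⟨hA hw.1 hb.1 hxA, fun hmem => hxB ?_⟩
    have := hB (hB hw.2 hb.2 hmem) hw.2 hw.2
    have e : w + b + (w + b + x) + w + w = x := by
      have h1 := ZModModule.add_self w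
      have h2 := ZModModule.add_self b
      calc _ = (w + w) + (w + w) + (b + b) + x := by abel
        _ = x := by simp [h1, h2]
    rwa [e] at this
  have := Finset.card_inter_add_card_sdiff A B
  omega

/-- If a flat `A` is half of a flat `B`, then elements of `B \ A` differ by differences of
elements of `A`: the set `B \ A` is a flat parallel to `A`. -/
theorem IsFlat.add_add_mem_of_sdiff (hA : IsFlat A) (hB : IsFlat B) (hAB : A ⊆ B)
    (h : B.card = 2 * A.card) {x y z : V} (hx : x ∈ A) (hy : y ∈ B \ A) (hz : z ∈ B \ A) :
    x + y + z ∈ A := by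
  rw [Finset.mem_sdiff] at hy
  have hsub : A.image (fun w => w + x + y) = B \ A := by
    refine Finset.eq_of_subset_of_card_le (fun v hv => ?_) ?_
    · obtain ⟨w, hw, rfl⟩ := Finset.mem_image.mp hv
      refine Finset.mem_sdiff.mpr ⟨hB (hAB hw) (hAB hx) hy.1, fun hmem => hy.2 ?_⟩
      have := hA hw hx hmem
      rwa [show w + x + (w + x + y) = y by
        rw [← add_assoc, ZModModule.add_self, zero_add]] at this
    · rw [Finset.card_image_of_injective _ (fun w w' h => by simpa using h),
        Finset.card_sdiff_of_subset hAB]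
      omega
  rw [← hsub] at hz
  obtain ⟨w, hw, rfl⟩ := Finset.mem_image.mp hz
  rwa [show x + y + (w + x + y) = w by
    calc _ = w + (x + x) + (y + y) := by abel
      _ = w := by simp [ZModModule.add_self]]

/-- If `A` and `A ∆ B` are flats, the latter twice as large as the former, and `B` is small, then
`A ∆ B` contains `A`, and `B` is the other half of it, a flat parallel to `A`. -/
theorem IsFlat.parallel_of_symmDiff (hA : IsFlat A) (hAB : IsFlat (symmDiff A B))
    (hcard : (symmDiff A B).card = 2 * A.card) (hlt : B.card < 2 * A.card) :
    ParallelFlats A B ∧ B.card = A.card := by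
  have hinter : A ∩ symmDiff A B = A \ B := by
    ext x; simp only [Finset.mem_inter, Finset.mem_symmDiff, Finset.mem_sdiff]; tauto
  have h1 := card_symmDiff_add A B
  have h2 := Finset.card_inter_add_card_sdiff A B
  have hsub : A ⊆ symmDiff A B := hA.subset_of_card_lt hAB (by rw [hinter]; omega)
  have hB : symmDiff A B \ A = B := by
    ext x
    have := @hsub x
    simp only [Finset.mem_symmDiff, Finset.mem_sdiff] at this ⊢
    tauto
  have hBc : B.card = A.card := by
    have := Finset.card_sdiff_of_subset hsub
    rw [hB] at this
    omega
  have mixed : ∀ x ∈ A, ∀ y ∈ B, ∀ z ∈ B, x + y + z ∈ A := fun x hx y hy z hz =>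
    hA.add_add_mem_of_sdiff hAB hsub hcard hx (by rwa [hB]) (by rwa [hB])
  have hBS : B ⊆ symmDiff A B := by
    intro x hx; rw [← hB] at hx; exact (Finset.mem_sdiff.mp hx).1
  have hdisj : ∀ x ∈ B, x ∉ A := by
    intro x hx; rw [← hB] at hx; exact (Finset.mem_sdiff.mp hx).2
  have hA0 : A.Nonempty := Finset.card_pos.mp (by omega)
  obtain ⟨a, ha⟩ := hA0
  refine ⟨⟨hA, fun x hx y hy z hz => ?_, mixed, fun x hx y hy z hz => ?_⟩, hBc⟩
  · rw [← hB, Finset.mem_sdiff]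
    refine ⟨hAB (hBS hx) (hBS hy) (hBS hz), fun hmem => hdisj x hx ?_⟩
    have := mixed _ hmem _ hy _ hz
    rwa [show x + y + z + y + z = x by
      calc _ = x + (y + y) + (z + z) := by abel
        _ = x := by simp [ZModModule.add_self]] at this
  · rw [← hB, Finset.mem_sdiff]
    refine ⟨hAB (hBS hx) (hsub hy) (hsub hz), fun hmem => hdisj x hx ?_⟩
    have := hA hmem hy hz
    rwa [show x + y + z + y + z = x by
      calc _ = x + (y + y) + (z + z) := by abel
        _ = x := by simp [ZModModule.add_self]] at this

end Flats

/-! ### Words of small weight -/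

section SmallWeight

/-- The support of a Boolean function. -/
def wordSupport {n : ℕ} (f : F2Word n) : Finset (F2Vec n) :=
  Finset.univ.filter fun x => f x ≠ 0

theorem mem_wordSupport {n : ℕ} {f : F2Word n} {x : F2Vec n} : x ∈ wordSupport f ↔ f x ≠ 0 := by
  simp [wordSupport]

theorem wordSupport_nonempty {n : ℕ} {f : F2Word n} (hf : f ≠ 0) : (wordSupport f).Nonempty := by
  obtain ⟨x, hx⟩ := Function.ne_iff.mp hf
  exact ⟨x, mem_wordSupport.mpr hx⟩

theorem wordSupport_zero {n : ℕ} : wordSupport (0 : F2Word n) = ∅ := by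
  simp [wordSupport]

theorem wordSupport_add {n : ℕ} (f g : F2Word n) :
    wordSupport (f + g) = symmDiff (wordSupport f) (wordSupport g) := by
  ext x
  rw [Finset.mem_symmDiff, mem_wordSupport, mem_wordSupport, mem_wordSupport, Pi.add_apply]
  generalize f x = a
  generalize g x = b
  revert a b
  decide

/-- The restriction of a Boolean function to the hyperplane where the first coordinate is `i`. -/
def wordSlice {n : ℕ} (f : F2Word (n + 1)) (i : ZMod 2) : F2Word n :=
  fun x => f (Fin.cons i x)

theorem zmod_two_cases : ∀ i : ZMod 2, i = 0 ∨ i = 1 := by decide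

theorem card_wordSupport_slice {n : ℕ} (f : F2Word (n + 1)) :
    (wordSupport f).card = (wordSupport (wordSlice f 0)).card +
      (wordSupport (wordSlice f 1)).card := by
  simp only [wordSupport, Finset.card_filter]
  rw [← (Fin.consEquiv fun _ : Fin (n + 1) => ZMod 2).sum_comp, Fintype.sum_prod_type]
  exact Fin.sum_univ_two _

theorem eq_zero_of_wordSlice {n : ℕ} {f : F2Word (n + 1)} (h0 : wordSlice f 0 = 0)
    (h1 : wordSlice f 1 = 0) : f = 0 := by
  funext x
  rw [← Fin.cons_self_tail x]
  rcases zmod_two_cases (x 0) with h | h <;> rw [h]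
  · exact congrFun h0 _
  · exact congrFun h1 _

theorem isFlat_of_parallel_slices {n : ℕ} {f : F2Word (n + 1)}
    (h : ParallelFlats (wordSupport (wordSlice f 0)) (wordSupport (wordSlice f 1))) :
    IsFlat (wordSupport f) := by
  obtain ⟨h0, h1, h01, h10⟩ := h
  have mem : ∀ v : F2Vec (n + 1), v ∈ wordSupport f ↔
      Fin.tail v ∈ wordSupport (wordSlice f (v 0)) := fun v => by
    rw [mem_wordSupport, mem_wordSupport, wordSlice, Fin.cons_self_tail]
  intro x hx y hy z hz
  rw [mem] at hx hy hz ⊢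
  have ht : Fin.tail (x + y + z) = Fin.tail x + Fin.tail y + Fin.tail z := rfl
  have ht' : Fin.tail (x + y + z) = Fin.tail y + Fin.tail x + Fin.tail z := by rw [ht]; abel
  have ht'' : Fin.tail (x + y + z) = Fin.tail z + Fin.tail x + Fin.tail y := by rw [ht]; abel
  have h2 : (1 : ZMod 2) + 1 = 0 := rfl
  rw [Pi.add_apply, Pi.add_apply]
  rcases zmod_two_cases (x 0) with a | a <;> rcases zmod_two_cases (y 0) with b | b <;>
    rcases zmod_two_cases (z 0) with c | c <;> rw [a] at hx ⊢ <;> rw [b] at hy ⊢ <;>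
    rw [c] at hz ⊢ <;> simp only [add_zero, zero_add, h2]
  · rw [ht]; exact h0 hx hy hz
  · rw [ht'']; exact h10 _ hz _ hx _ hy
  · rw [ht']; exact h10 _ hy _ hx _ hz
  · rw [ht]; exact h01 _ hx _ hy _ hz
  · rw [ht]; exact h10 _ hx _ hy _ hz
  · rw [ht']; exact h01 _ hy _ hx _ hz
  · rw [ht'']; exact h01 _ hz _ hx _ hy
  · rw [ht]; exact h1 hx hy hz

theorem DegreeLT.slice {n k : ℕ} {f : F2Word (n + 1)} (hf : DegreeLT k f) (i : ZMod 2) :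
    DegreeLT k (wordSlice f i) := by
  let L : F2Vec n →+ F2Vec (n + 1) :=
    { toFun := fun x => Fin.cons 0 x
      map_zero' := by ext j; refine Fin.cases ?_ (fun _ => ?_) j <;> simp
      map_add' := fun x y => by ext j; refine Fin.cases ?_ (fun _ => ?_) j <;> simp }
  -- the slice at `i` is the translate by `(i, 0)`, restricted along `x ↦ (0, x)`
  have h := (hf.comp_add_right (Fin.cons i 0)).comp_hom L
  convert h using 2 with x
  refine congrArg f ?_
  ext j
  refine Fin.cases ?_ (fun _ => ?_) j <;> simp [L]

/-- The sum of the two slices is a slice of a difference of the function, so its degree is one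
lower. -/
theorem DegreeLT.slice_add_slice {n k : ℕ} {f : F2Word (n + 1)} (hf : DegreeLT (k + 1) f) :
    DegreeLT k (wordSlice f 0 + wordSlice f 1) := by
  have h := (hf (Fin.cons 1 0)).slice 1
  convert h using 1
  funext x
  have e : (Fin.cons 1 x + Fin.cons 1 0 : F2Vec (n + 1)) = Fin.cons 0 x := by
    ext j
    refine Fin.cases ?_ (fun _ => ?_) j
    · exact (rfl : (1 : ZMod 2) + 1 = 0)
    · simp
  simp only [wordSlice, Pi.add_apply, e]

theorem DegreeLT.wordSupport_eq_univ {n : ℕ} {f : F2Word n} (hf : DegreeLT 1 f) (h0 : f ≠ 0) :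
    wordSupport f = Finset.univ := by
  obtain ⟨x, hx⟩ := Function.ne_iff.mp h0
  refine Finset.eq_univ_of_forall fun y => mem_wordSupport.mpr ?_
  rwa [hf.eq_const y, ← hf.eq_const x]

theorem card_f2Vec (n : ℕ) : Fintype.card (F2Vec n) = 2 ^ n := by simp

/-- A nonzero Boolean function of degree at most `r` in `n` variables has weight at least
`2 ^ (n - r)`. -/
theorem DegreeLT.le_card_wordSupport {n r : ℕ} {f : F2Word n} (hf : DegreeLT (r + 1) f)
    (h0 : f ≠ 0) : 2 ^ n ≤ (wordSupport f).card * 2 ^ r := by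
  induction n generalizing r with
  | zero =>
    have := (wordSupport_nonempty h0).card_pos
    have := Nat.one_le_two_pow (n := r)
    nlinarith
  | succ n ih =>
    cases r with
    | zero => rw [hf.wordSupport_eq_univ h0, Finset.card_univ, card_f2Vec]; simp
    | succ r =>
      have hadd := hf.slice_add_slice
      rw [card_wordSupport_slice, pow_succ 2 n, add_mul]
      by_cases h00 : wordSlice f 0 = 0
      · rw [h00, zero_add] at hadd
        have := ih hadd fun h1 => h0 (eq_zero_of_wordSlice h00 h1)
        rw [h00, wordSupport_zero, pow_succ]
        simp only [Finset.card_empty]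
        linarith
      by_cases h11 : wordSlice f 1 = 0
      · rw [h11, add_zero] at hadd
        have := ih hadd h00
        rw [h11, wordSupport_zero, pow_succ]
        simp only [Finset.card_empty]
        linarith
      have := ih (hf.slice 0) h00
      have := ih (hf.slice 1) h11
      linarith

/-- A nonzero Boolean function of degree at most `r` in `n` variables whose weight is less than
`3 / 2` times the minimum `2 ^ (n - r)` is the indicator of a flat of dimension `n - r`.

The proof is by induction on `n`. Let `A` and `B` be the supports of the two slices. The sum of the
slices has degree at most `r - 1` and weight below `3 / 2` of the minimum for that degree, so
`A ∆ B` is empty or a flat, and the smaller of `A` and `B` is empty or a flat too. -/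
theorem DegreeLT.isFlat_wordSupport {n r : ℕ} {f : F2Word n} (hf : DegreeLT (r + 1) f)
    (h0 : f ≠ 0) (hlt : 2 * ((wordSupport f).card * 2 ^ r) < 3 * 2 ^ n) :
    IsFlat (wordSupport f) ∧ (wordSupport f).card * 2 ^ r = 2 ^ n := by
  induction n generalizing r with
  | zero =>
    have hc := (wordSupport_nonempty h0).card_pos
    refine ⟨fun x hx y _ z _ => by rwa [Subsingleton.elim (x + y + z) x], ?_⟩
    have := Nat.one_le_two_pow (n := r)
    have : 0 < (wordSupport f).card * 2 ^ r := by positivity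
    omega
  | succ n ih =>
    cases r with
    | zero =>
      rw [hf.wordSupport_eq_univ h0, Finset.card_univ, card_f2Vec]
      exact ⟨fun _ _ _ _ _ _ => Finset.mem_univ _, by simp⟩
    | succ r =>
      have hadd := hf.slice_add_slice
      have hf0 := hf.slice 0
      have hf1 := hf.slice 1
      have hc := card_wordSupport_slice f
      have hpar := @isFlat_of_parallel_slices n f
      have hz := @eq_zero_of_wordSlice n f
      revert hadd hf0 hf1 hc hpar hz
      generalize wordSlice f 0 = f0
      generalize wordSlice f 1 = f1
      intro hadd hf0 hf1 hc hpar hz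
      have hsupp := wordSupport_add f0 f1
      rw [hc] at hlt ⊢
      rw [pow_succ 2 r, pow_succ 2 n] at hlt ⊢
      by_cases h00 : f0 = 0
      · subst h00
        rw [zero_add] at hadd
        rw [wordSupport_zero, Finset.card_empty] at hlt ⊢
        obtain ⟨hfl, hcard⟩ := ih hadd (fun h1 => h0 (hz rfl h1)) (by linarith)
        exact ⟨hpar (by rw [wordSupport_zero]; exact hfl.parallel_empty.symm), by linarith⟩
      by_cases h11 : f1 = 0
      · subst h11
        rw [add_zero] at hadd
        rw [wordSupport_zero, Finset.card_empty] at hlt ⊢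
        obtain ⟨hfl, hcard⟩ := ih hadd h00 (by linarith)
        exact ⟨hpar (by rw [wordSupport_zero]; exact hfl.parallel_empty), by linarith⟩
      have hle0 := hf0.le_card_wordSupport h00
      have hle1 := hf1.le_card_wordSupport h11
      have hR : 0 < 2 ^ r := by positivity
      have hsc : (wordSupport (f0 + f1)).card ≤ (wordSupport f0).card + (wordSupport f1).card := by
        rw [hsupp]
        exact (Finset.card_le_card Finset.symmDiff_subset_union).trans (Finset.card_union_le _ _)
      have hsc' := Nat.mul_le_mul_right (2 ^ r) hsc
      by_cases hs : f0 + f1 = 0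
      · obtain rfl : f0 = f1 := by
          funext x
          exact CharTwo.add_eq_zero.mp (congrFun hs x)
        obtain ⟨hfl, hcard⟩ := ih hf0 h00 (by rw [pow_succ]; linarith)
        rw [pow_succ] at hcard
        exact ⟨hpar hfl.parallel_self, by linarith⟩
      obtain ⟨hfl, hcard⟩ := ih hadd hs (by linarith)
      rw [pow_succ] at hle0 hle1
      rw [hsupp] at hfl hcard
      rcases le_total (wordSupport f0).card (wordSupport f1).card with hle | hle
      · have hle' := Nat.mul_le_mul_right (2 ^ r) hle
        obtain ⟨hfl0, hcard0⟩ := ih hf0 h00 (by rw [pow_succ]; linarith)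
        rw [pow_succ] at hcard0
        obtain ⟨hp, he⟩ := hfl0.parallel_of_symmDiff hfl
          (Nat.eq_of_mul_eq_mul_right hR (by linarith))
          (lt_of_mul_lt_mul_right (a := 2 ^ r) (by linarith) hR.le)
        exact ⟨hpar hp, by rw [he]; linarith⟩
      · have hle' := Nat.mul_le_mul_right (2 ^ r) hle
        obtain ⟨hfl1, hcard1⟩ := ih hf1 h11 (by rw [pow_succ]; linarith)
        rw [pow_succ] at hcard1
        rw [symmDiff_comm] at hfl hcard
        obtain ⟨hp, he⟩ := hfl1.parallel_of_symmDiff hfl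
          (Nat.eq_of_mul_eq_mul_right hR (by linarith))
          (lt_of_mul_lt_mul_right (a := 2 ^ r) (by linarith) hR.le)
        exact ⟨hpar hp.symm, by rw [he]; linarith⟩

end SmallWeight

/-! ### Power sums over flats -/

/-- If `A` is a flat in a field of characteristic two, then `∑ x ∈ A, x ^ (#A - 1)` is the product
of the nonzero elements `a - w` of its direction. All the denominators in Lagrange's formula for the
leading coefficient of the interpolation of `X ^ (#A - 1)` on `A` are equal to this product. -/
theorem IsFlat.sum_pow_card_sub_one {K : Type*} [Field K] [Algebra (ZMod 2) K] [DecidableEq K]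
    {A : Finset K} (hA : IsFlat A) {a : K} (ha : a ∈ A) :
    ∑ x ∈ A, x ^ (A.card - 1) = ∏ w ∈ A.erase a, (a - w) := by
  have : CharP K 2 := charP_of_injective_algebraMap (algebraMap (ZMod 2) K).injective 2
  have hself (x : K) : x + x = 0 := ZModModule.add_self x
  have hdenom : ∀ x ∈ A, ∏ w ∈ A.erase x, (x - w) = ∏ w ∈ A.erase a, (a - w) := by
    intro x hx
    refine Finset.prod_bij' (fun w _ => w + x + a) (fun w _ => w + x + a) ?_ ?_ ?_ ?_ ?_
    · intro w hw
      rw [Finset.mem_erase] at hw ⊢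
      exact ⟨fun h => hw.1 (CharTwo.add_eq_zero.mp (by linear_combination h)), hA hw.2 hx ha⟩
    · intro w hw
      rw [Finset.mem_erase] at hw ⊢
      exact ⟨fun h => hw.1 (CharTwo.add_eq_zero.mp (by linear_combination h)), hA hw.2 hx ha⟩
    · intro w _
      linear_combination hself x + hself a
    · intro w _
      linear_combination hself x + hself a
    · intro w _
      linear_combination hself x
  have hcard : A.card ≠ 0 := Finset.card_ne_zero_of_mem ha
  have h := Lagrange.coeff_eq_sum (s := A) (v := id) (Function.injective_id.injOn)
    (P := (Polynomial.X : Polynomial K) ^ (A.card - 1))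
    (by rw [Polynomial.degree_X_pow]; exact_mod_cast Nat.sub_lt (Nat.pos_of_ne_zero hcard) one_pos)
  rw [Polynomial.coeff_X_pow_self] at h
  have hM : ∏ w ∈ A.erase a, (a - w) ≠ 0 := Finset.prod_ne_zero_iff.mpr fun w hw =>
    sub_ne_zero.mpr (Finset.ne_of_mem_erase hw).symm
  have h' : (1 : K) = (∑ x ∈ A, x ^ (A.card - 1)) / ∏ w ∈ A.erase a, (a - w) := by
    rw [h, Finset.sum_div]
    refine Finset.sum_congr rfl fun x hx => ?_
    simp only [id, Polynomial.eval_pow, Polynomial.eval_X]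
    rw [hdenom x hx]
  rw [eq_div_iff hM, one_mul] at h'
  exact h'.symm

theorem IsFlat.sum_pow_card_sub_one_ne_zero {K : Type*} [Field K] [Algebra (ZMod 2) K]
    {A : Finset K} (hA : IsFlat A) (hne : A.Nonempty) : ∑ x ∈ A, x ^ (A.card - 1) ≠ 0 := by
  classical
  obtain ⟨a, ha⟩ := hne
  rw [hA.sum_pow_card_sub_one ha]
  exact Finset.prod_ne_zero_iff.mpr fun w hw => sub_ne_zero.mpr (Finset.ne_of_mem_erase hw).symm

/-! ### The additive function vanishing on a subspace -/

/-- The monic polynomial with the elements of a finite additive subgroup as its simple roots induces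
an additive function: for fixed `y` the difference of the two sides has too many zeros `x`. -/
theorem prod_add_sub_eq {R G : Type*} [CommRing R] [IsDomain R] [AddCommGroup G] [Fintype G]
    {ι : G →+ R} (hι : Function.Injective ι) (x y : R) :
    ∏ g, (x + y - ι g) = ∏ g, (x - ι g) + ∏ g, (y - ι g) := by
  open Polynomial in
  let P (z : R) : R[X] := ∏ g, (X - C (ι g - z))
  have hP (z t : R) : (P z).eval t = ∏ g, (t + z - ι g) := by
    simp only [P, eval_prod, eval_sub, eval_X, eval_C]
    exact Finset.prod_congr rfl fun g _ => by ring
  have hdeg (z : R) : (P z).degree = Fintype.card G := by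
    simp only [P, degree_prod, degree_X_sub_C, Finset.sum_const, Finset.card_univ, nsmul_one]
  have hmonic (z : R) : (P z).Monic := monic_prod_of_monic _ _ fun g _ => monic_X_sub_C _
  let Q : R[X] := P y - P 0 - C (∏ g, (y - ι g))
  have hQ : Q = 0 := by
    have hlt : Q.degree < Fintype.card G := by
      refine (degree_sub_le _ _).trans_lt (max_lt ?_ ?_)
      · refine (degree_sub_lt_left ((hdeg y).trans (hdeg 0).symm) (hmonic y).ne_zero ?_).trans_eq
          (hdeg y)
        rw [(hmonic y).leadingCoeff, (hmonic 0).leadingCoeff]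
      · exact degree_C_le.trans_lt (by exact_mod_cast Fintype.card_pos)
    by_contra hne
    refine hne (eq_zero_of_natDegree_lt_card_of_eval_eq_zero Q hι (fun h => ?_)
      ((natDegree_lt_iff_degree_lt hne).mpr hlt))
    simp only [Q, eval_sub, hP, eval_C, add_zero]
    have h1 : ∏ g, (ι h - ι g) = 0 :=
      Finset.prod_eq_zero (Finset.mem_univ h) (sub_self _)
    have h2 : ∏ g, (ι h + y - ι g) = ∏ g, (y - ι g) := by
      rw [← Equiv.prod_comp (Equiv.addRight h)]
      refine Finset.prod_congr rfl fun g _ => ?_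
      rw [Equiv.coe_addRight, map_add]
      ring
    rw [h1, h2]
    ring
  have h := congrArg (eval x) hQ
  simp only [Q, eval_sub, hP, eval_C, add_zero, eval_zero] at h
  linear_combination h

section Vanishing

variable {K : Type*} [Field K] [Algebra (ZMod 2) K]

/-- The `𝔽₂`-linear function `x ↦ ∏ u ∈ U, (x - u)` on a field of characteristic two, whose kernel
is the finite subspace `U`. -/
noncomputable def vanishingMap (U : Submodule (ZMod 2) K) [Fintype U] : K →ₗ[ZMod 2] K :=
  AddMonoidHom.toZModLinearMap 2
    { toFun := fun x => ∏ u : U, (x - u)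
      map_zero' := Finset.prod_eq_zero (Finset.mem_univ 0) (by simp)
      map_add' := prod_add_sub_eq (ι := U.toAddSubgroup.subtype) Subtype.val_injective }

theorem vanishingMap_apply (U : Submodule (ZMod 2) K) [Fintype U] (x : K) :
    vanishingMap U x = ∏ u : U, (x - u) := rfl

theorem ker_vanishingMap (U : Submodule (ZMod 2) K) [Fintype U] :
    LinearMap.ker (vanishingMap U) = U := by
  ext x
  rw [LinearMap.mem_ker, vanishingMap_apply, Finset.prod_eq_zero_iff]
  constructor
  · rintro ⟨u, -, hu⟩
    rw [sub_eq_zero.mp hu]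
    exact u.2
  · exact fun hx => ⟨⟨x, hx⟩, Finset.mem_univ _, sub_self _⟩

open Polynomial in
/-- If `U` is the range of `vanishingMap T`, then `vanishingMap U` maps into `T`. Let `B` be the
polynomial with the elements of `T` as its roots, and `A` that of `U`. Then
`A ∘ B = X ^ q - X`, and as `X ^ q` commutes with `B`, also `B ∘ A = X ^ q - X`. -/
theorem vanishingMap_vanishingMap_range [Fintype K] {T U : Submodule (ZMod 2) K} [Fintype T]
    [Fintype U] (hU : U = LinearMap.range (vanishingMap T)) (x : K) :
    vanishingMap T (vanishingMap U x) = 0 := by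
  let A : K[X] := ∏ u : U, (X - C (u : K))
  let B : K[X] := ∏ t : T, (X - C (t : K))
  let Z : K[X] := X ^ Fintype.card K - X
  have hA (y : K) : A.eval y = vanishingMap U y := by simp [A, eval_prod, vanishingMap_apply]
  have hB (y : K) : B.eval y = vanishingMap T y := by simp [B, eval_prod, vanishingMap_apply]
  have hq : 1 < Fintype.card K := Fintype.one_lt_card
  have hAm : A.Monic := monic_prod_of_monic _ _ fun g _ => monic_X_sub_C _
  have hBm : B.Monic := monic_prod_of_monic _ _ fun g _ => monic_X_sub_C _
  have hAd : A.natDegree = Fintype.card U := by simp [A, natDegree_prod_of_monic, monic_X_sub_C]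
  have hBd : B.natDegree = Fintype.card T := by simp [B, natDegree_prod_of_monic, monic_X_sub_C]
  have hB0 : B.natDegree ≠ 0 := by rw [hBd]; exact Fintype.card_ne_zero
  have hcard : Fintype.card U * Fintype.card T = Fintype.card K := by
    have h := LinearMap.finrank_range_add_finrank_ker (vanishingMap T)
    rw [ker_vanishingMap, ← hU] at h
    rw [Module.card_eq_pow_finrank (K := ZMod 2) (V := U),
      Module.card_eq_pow_finrank (K := ZMod 2) (V := T),
      Module.card_eq_pow_finrank (K := ZMod 2) (V := K), ← pow_add, h]
  have hABm : (A.comp B).Monic := hAm.comp hBm hB0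
  have hZm : Z.Monic :=
    monic_X_pow_sub (by rw [degree_X]; exact_mod_cast hq)
  have hZd : Z.natDegree = Fintype.card K := FiniteField.X_pow_card_sub_X_natDegree_eq K hq
  have hAB : A.comp B = Z := by
    have hd : (A.comp B).degree = Z.degree := by
      rw [degree_eq_natDegree hABm.ne_zero, degree_eq_natDegree hZm.ne_zero, natDegree_comp,
        hAd, hBd, hZd, hcard]
    rw [← sub_eq_zero]
    by_contra hne
    refine hne (eq_zero_of_natDegree_lt_card_of_eval_eq_zero _ Function.injective_id
      (fun y => ?_) ?_)
    · have : vanishingMap U (vanishingMap T y) = 0 := by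
        rw [← LinearMap.mem_ker, ker_vanishingMap, hU]
        exact ⟨y, rfl⟩
      simp [Z, eval_comp, hA, hB, this, FiniteField.pow_card]
    · rw [natDegree_lt_iff_degree_lt hne]
      refine (degree_sub_lt_left hd hABm.ne_zero
        (hABm.leadingCoeff.trans hZm.leadingCoeff.symm)).trans_eq ?_
      rw [hd, degree_eq_natDegree hZm.ne_zero, hZd]
  have hBZ : B.comp Z = Z.comp B := by
    have hcomp (p : K[X]) : B.comp p = ∏ t : T, (p - C (t : K)) := by simp [B, prod_comp]
    have hadd : B.comp (X ^ Fintype.card K) = B.comp Z + B.comp X := by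
      rw [hcomp, hcomp, hcomp]
      have := prod_add_sub_eq (ι := (C : K →+* K[X]).toAddMonoidHom.comp T.toAddSubgroup.subtype)
        (C_injective.comp Subtype.val_injective) Z X
      rw [sub_add_cancel] at this
      exact this
    rw [comp_X, ← expand_eq_comp_X_pow, FiniteField.expand_card] at hadd
    rw [sub_comp, X_pow_comp, X_comp, hadd, add_sub_cancel_right]
  have hBA : B.comp A = Z := by
    have h : (B.comp A - Z).comp B = 0 := by
      rw [sub_comp, comp_assoc, hAB, hBZ, sub_self]
    rcases comp_eq_zero_iff.mp h with h | ⟨-, h⟩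
    · exact sub_eq_zero.mp h
    · exact absurd (by rw [h, natDegree_C]) hB0
  rw [← hA, ← hB, ← eval_comp, hBA]
  simp [Z, FiniteField.pow_card]

/-- Every subspace of a finite field is the range of a map `vanishingMap U`. -/
theorem exists_range_vanishingMap_eq [Fintype K] (T : Submodule (ZMod 2) K) :
    ∃ (U : Submodule (ZMod 2) K) (_ : Fintype U), LinearMap.range (vanishingMap U) = T ∧
      Module.finrank (ZMod 2) T + Module.finrank (ZMod 2) U = Module.finrank (ZMod 2) K := by
  have : Fintype T := Fintype.ofFinite T
  have : Fintype (LinearMap.range (vanishingMap T)) := Fintype.ofFinite _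
  have h1 := LinearMap.finrank_range_add_finrank_ker (vanishingMap T)
  have h2 := LinearMap.finrank_range_add_finrank_ker
    (vanishingMap (LinearMap.range (vanishingMap T)))
  rw [ker_vanishingMap] at h1 h2
  refine ⟨LinearMap.range (vanishingMap T), inferInstance, ?_, by omega⟩
  refine Submodule.eq_of_le_of_finrank_eq ?_ (by omega)
  rintro _ ⟨x, rfl⟩
  have := vanishingMap_vanishingMap_range (T := T) rfl x
  rwa [← LinearMap.mem_ker, ker_vanishingMap] at this

end Vanishing

section Vanishing

variable {K : Type*} [Field K] [Algebra (ZMod 2) K] [Fintype K]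

open Classical in
/-- The nonzero elements of a subspace of a finite field. -/
noncomputable def nonzeroElements (V : Submodule (ZMod 2) K) : Finset K :=
  Finset.univ.filter fun x => x ∈ V ∧ x ≠ 0

theorem mem_nonzeroElements {V : Submodule (ZMod 2) K} {x : K} :
    x ∈ nonzeroElements V ↔ x ∈ V ∧ x ≠ 0 := by simp [nonzeroElements]

open Classical in
theorem isFlat_submodule (V : Submodule (ZMod 2) K) : IsFlat (Finset.univ.filter (· ∈ V)) := by
  intro x hx y hy z hz
  simp only [Finset.mem_filter, Finset.mem_univ, true_and] at hx hy hz ⊢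
  exact V.add_mem (V.add_mem hx hy) hz

theorem card_nonzeroElements (V : Submodule (ZMod 2) K) :
    (nonzeroElements V).card + 1 = 2 ^ Module.finrank (ZMod 2) V := by
  classical
  have h : nonzeroElements V = (Finset.univ.filter (· ∈ V)).erase 0 := by
    ext x; simp [mem_nonzeroElements, and_comm]
  rw [h, Finset.card_erase_add_one (by simp), ← Fintype.card_subtype]
  have hc := Module.card_eq_pow_finrank (K := ZMod 2) (V := V)
  rwa [ZMod.card] at hc

open Classical in
/-- The power sum of exponent `|V| - 1` over a subspace `V` is the product of its nonzero
elements. -/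
theorem sum_pow_submodule {s : ℕ} (V : Submodule (ZMod 2) K)
    (hV : Module.finrank (ZMod 2) V = s) :
    ∑ x ∈ Finset.univ.filter (· ∈ V), x ^ (2 ^ s - 1) = ∏ v ∈ nonzeroElements V, v := by
  have hcard : (Finset.univ.filter (· ∈ V)).card = 2 ^ s := by
    rw [← Fintype.card_subtype, Module.card_eq_pow_finrank (K := ZMod 2) (V := V), hV, ZMod.card]
  rw [← hcard, (isFlat_submodule V).sum_pow_card_sub_one (a := 0) (by simp)]
  refine Finset.prod_congr ?_ fun x _ => ?_
  · ext x; simp [mem_nonzeroElements, and_comm]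
  · rw [zero_sub, ZModModule.neg_eq_self]

variable {U P : Submodule (ZMod 2) K} [Fintype U]

/-- For `w` in the range of `vanishingMap U`, the fibre over `w` is a translate `v + U`; it has
as many elements as `U`, and their product is `w`. -/
theorem fiber_vanishingMap {w : K} (hw : w ∈ LinearMap.range (vanishingMap U))
    [DecidablePred fun v => vanishingMap U v = w] :
    (Finset.univ.filter fun v => vanishingMap U v = w).card = Fintype.card U ∧
    ∏ v ∈ Finset.univ.filter (fun v => vanishingMap U v = w), v = w := by
  classical
  obtain ⟨v₀, rfl⟩ := hw
  have hinj : Function.Injective fun u : U => v₀ - (u : K) := fun u u' h =>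
    Subtype.ext (sub_right_injective h)
  have himage : Finset.univ.filter (fun v => vanishingMap U v = vanishingMap U v₀) =
      Finset.univ.image fun u : U => v₀ - (u : K) := by
    ext v
    simp only [Finset.mem_filter, Finset.mem_univ, true_and, Finset.mem_image]
    constructor
    · intro h
      refine ⟨⟨v₀ - v, ?_⟩, by simp⟩
      rw [← ker_vanishingMap U, LinearMap.mem_ker, map_sub, h, sub_self]
    · rintro ⟨u, rfl⟩
      have hu : (u : K) ∈ LinearMap.ker (vanishingMap U) := by rw [ker_vanishingMap]; exact u.2
      rw [map_sub, LinearMap.mem_ker.mp hu, sub_zero]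
  rw [himage]
  exact ⟨by rw [Finset.card_image_of_injective _ hinj, Finset.card_univ],
    by rw [Finset.prod_image hinj.injOn, vanishingMap_apply]⟩

theorem nonzeroElements_comap_eq [DecidableEq K] : nonzeroElements (P.comap (vanishingMap U)) =
    nonzeroElements U ∪
      (nonzeroElements P).biUnion fun w => Finset.univ.filter fun v => vanishingMap U v = w := by
  ext v
  simp only [mem_nonzeroElements, Finset.mem_union, Finset.mem_biUnion, Finset.mem_filter,
    Finset.mem_univ, true_and, Submodule.mem_comap, exists_eq_right']
  have hv : v ∈ U ↔ vanishingMap U v = 0 := by rw [← LinearMap.mem_ker, ker_vanishingMap]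
  rw [hv]
  by_cases h : vanishingMap U v = 0
  · simp [h]
  · have : v ≠ 0 := by rintro rfl; simp at h
    simp [h, this]

theorem disjoint_nonzeroElements_fibers [DecidableEq K] : Disjoint (nonzeroElements U)
    ((nonzeroElements P).biUnion fun w => Finset.univ.filter fun v => vanishingMap U v = w) := by
  rw [Finset.disjoint_left]
  intro v hv h
  simp only [mem_nonzeroElements, Finset.mem_biUnion, Finset.mem_filter,
    Finset.mem_univ, true_and, exists_eq_right'] at hv h
  rw [← ker_vanishingMap U, LinearMap.mem_ker] at hv
  exact h.2 hv.1

theorem pairwiseDisjoint_fibers [DecidableEq K] :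
    ((nonzeroElements P : Finset K) : Set K).PairwiseDisjoint
      fun w => Finset.univ.filter fun v => vanishingMap U v = w := by
  intro w _ w' _ hne
  rw [Function.onFun, Finset.disjoint_left]
  intro v hv hv'
  rw [Finset.mem_filter] at hv hv'
  exact hne (hv.2.symm.trans hv'.2)

theorem prod_nonzeroElements_comap [DecidableEq K] (hP : P ≤ LinearMap.range (vanishingMap U)) :
    ∏ v ∈ nonzeroElements (P.comap (vanishingMap U)), v =
      (∏ u ∈ nonzeroElements U, u) * ∏ w ∈ nonzeroElements P, w := by
  rw [nonzeroElements_comap_eq, Finset.prod_union disjoint_nonzeroElements_fibers,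
    Finset.prod_biUnion pairwiseDisjoint_fibers]
  congr 1
  exact Finset.prod_congr rfl fun w hw => (fiber_vanishingMap (hP (mem_nonzeroElements.mp hw).1)).2

theorem finrank_comap_vanishingMap [DecidableEq K]
    (hP : P ≤ LinearMap.range (vanishingMap U)) :
    Module.finrank (ZMod 2) (P.comap (vanishingMap U)) =
      Module.finrank (ZMod 2) U + Module.finrank (ZMod 2) P := by
  have hU := card_nonzeroElements U
  have hPc := card_nonzeroElements P
  have h := card_nonzeroElements (P.comap (vanishingMap U))
  rw [nonzeroElements_comap_eq, Finset.card_union_of_disjoint disjoint_nonzeroElements_fibers,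
    Finset.card_biUnion pairwiseDisjoint_fibers, Finset.sum_congr rfl fun w hw =>
      (fiber_vanishingMap (hP (mem_nonzeroElements.mp hw).1)).1, Finset.sum_const,
    smul_eq_mul, Module.card_eq_pow_finrank (K := ZMod 2) (V := U), ZMod.card,
    add_right_comm, hU] at h
  refine Nat.pow_right_injective le_rfl ?_
  show 2 ^ _ = 2 ^ _
  rw [← h, pow_add, ← hPc]
  ring

end Vanishing

/-! ### Subspaces with equal products of nonzero elements -/

section Planes

variable {K : Type*} [Field K] [Algebra (ZMod 2) K]

theorem nonzeroElements_span_pair [Fintype K] [DecidableEq K] {a b : K} (h : a * b * (a + b) ≠ 0) :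
    nonzeroElements (Submodule.span (ZMod 2) {a, b}) = {a, b, a + b} := by
  simp only [mul_ne_zero_iff] at h
  ext x
  simp only [mem_nonzeroElements, Submodule.mem_span_pair, Finset.mem_insert,
    Finset.mem_singleton]
  constructor
  · rintro ⟨⟨i, j, rfl⟩, hx⟩
    rcases zmod_two_cases i with rfl | rfl <;> rcases zmod_two_cases j with rfl | rfl <;>
      simp_all
  · rintro (rfl | rfl | rfl)
    · exact ⟨⟨1, 0, by simp⟩, h.1.1⟩
    · exact ⟨⟨0, 1, by simp⟩, h.1.2⟩
    · exact ⟨⟨1, 1, by simp⟩, h.2⟩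

theorem ne_of_mul_mul_add_ne_zero {a b : K} (h : a * b * (a + b) ≠ 0) : a ≠ b := by
  rintro rfl
  simp [ZModModule.add_self] at h

theorem prod_nonzeroElements_span_pair [Fintype K] {a b : K} (h : a * b * (a + b) ≠ 0) :
    ∏ x ∈ nonzeroElements (Submodule.span (ZMod 2) {a, b}), x = a * b * (a + b) := by
  classical
  have h' := h
  simp only [mul_ne_zero_iff] at h'
  rw [nonzeroElements_span_pair h, Finset.prod_insert, Finset.prod_pair, mul_assoc]
  · simpa using h'.1.1
  · simpa [h'.1.2] using ne_of_mul_mul_add_ne_zero h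

theorem finrank_span_pair [Fintype K] {a b : K} (h : a * b * (a + b) ≠ 0) :
    Module.finrank (ZMod 2) (Submodule.span (ZMod 2) {a, b}) = 2 := by
  classical
  have h' := h
  simp only [mul_ne_zero_iff] at h'
  have hc := card_nonzeroElements (Submodule.span (ZMod 2) {a, b})
  rw [nonzeroElements_span_pair h, Finset.card_insert_of_notMem, Finset.card_pair] at hc
  · exact (Nat.pow_right_injective le_rfl hc).symm
  · simpa using h'.1.1
  · simpa [h'.1.2] using ne_of_mul_mul_add_ne_zero h

/-- In a field with at least 16 elements and characteristic two there are two planes, meeting only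
in `0`, whose nonzero elements have the same product. They are found as the spans of `1, b` and
of `a, d`: the products are `b² + b` and `a² d + a d²`, which are additive in `(b, d)`. -/
theorem exists_planes_prod_eq [Fintype K] (hK : 4 ≤ Module.finrank (ZMod 2) K) :
    ∃ a b c d : K, a * b * (a + b) ≠ 0 ∧ a * b * (a + b) = c * d * (c + d) ∧
      ∀ x, (x = a ∨ x = b ∨ x = a + b) → ¬ (x = c ∨ x = d ∨ x = c + d) := by
  classical
  have : CharP K 2 := charP_of_injective_algebraMap (algebraMap (ZMod 2) K).injective 2
  have h2 : (2 : K) = 0 := CharTwo.two_eq_zero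
  obtain ⟨a, ha⟩ : ∃ a : K, a ∉ ({0, 1} : Finset K) := by
    by_contra! h
    have hle := Finset.card_le_card (fun x _ => h x : (Finset.univ : Finset K) ⊆ {0, 1})
    have := Finset.card_le_two (a := (0 : K)) (b := 1)
    rw [Finset.card_univ, Module.card_eq_pow_finrank (K := ZMod 2) (V := K), ZMod.card] at hle
    have := Nat.pow_le_pow_right (n := 2) two_pos hK
    omega
  simp only [Finset.mem_insert, Finset.mem_singleton, not_or] at ha
  obtain ⟨ha0, ha1⟩ := ha
  let g : K × K →ₗ[ZMod 2] K := AddMonoidHom.toZModLinearMap 2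
    { toFun := fun p => p.1 ^ 2 + p.1 + a ^ 2 * p.2 + a * p.2 ^ 2
      map_zero' := by simp
      map_add' := fun p q => by
        simp only [Prod.fst_add, Prod.snd_add]
        linear_combination (p.1 * q.1 + a * p.2 * q.2) * h2 }
  have hg (b d : K) : g (b, d) = b ^ 2 + b + a ^ 2 * d + a * d ^ 2 := rfl
  have hker : 4 ≤ Module.finrank (ZMod 2) (LinearMap.ker g) := by
    have h := LinearMap.finrank_range_add_finrank_ker g
    have := Submodule.finrank_le (LinearMap.range g)
    rw [Module.finrank_prod] at h
    omega
  have hcard : 16 ≤ (Finset.univ.filter fun p => p ∈ LinearMap.ker g).card := by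
    rw [← Fintype.card_subtype, Module.card_eq_pow_finrank (K := ZMod 2) (V := LinearMap.ker g),
      ZMod.card]
    exact Nat.pow_le_pow_right (n := 2) two_pos hker
  -- the pairs in the kernel for which the planes are degenerate or equal
  let bad : Finset (K × K) := ({0, 1} : Finset K) ×ˢ {0, a} ∪ ({a, a + 1} : Finset K) ×ˢ {1, a + 1}
  have hbad : bad.card ≤ 8 := by
    refine (Finset.card_union_le _ _).trans ?_
    rw [Finset.card_product, Finset.card_product]
    exact Nat.add_le_add (Nat.mul_le_mul Finset.card_le_two Finset.card_le_two)
      (Nat.mul_le_mul Finset.card_le_two Finset.card_le_two)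
  obtain ⟨⟨b, d⟩, hp, hpbad⟩ := Finset.exists_mem_notMem_of_card_lt_card
    (show bad.card < (Finset.univ.filter fun p => p ∈ LinearMap.ker g).card by omega)
  rw [Finset.mem_filter, LinearMap.mem_ker, hg] at hp
  have hbd := hp.2
  simp only [bad, Finset.mem_union, Finset.mem_product, Finset.mem_insert, Finset.mem_singleton,
    not_or, not_and] at hpbad
  obtain ⟨hbad1, hbad2⟩ := hpbad
  have hb01 : ¬ (b = 0 ∨ b = 1) := fun hb => by
    have hz : b ^ 2 + b = 0 := by
      rcases hb with rfl | rfl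
      · ring
      · linear_combination h2
    obtain ⟨hd0, hda⟩ := hbad1 hb
    have : a * d * (d - a) = 0 := by linear_combination hbd - hz - a ^ 2 * d * h2
    simp [ha0, hd0, sub_eq_zero, hda] at this
  have hba : ¬ (b = a ∨ b = a + 1) := fun hb => by
    have hz : b ^ 2 + b = a ^ 2 + a := by
      rcases hb with rfl | rfl
      · rfl
      · linear_combination (a + 1) * h2
    obtain ⟨hd0, hda⟩ := hbad2 hb
    have : a * (d - 1) * (d - (a + 1)) = 0 := by
      linear_combination hbd - hz - a * d * (a + 1) * h2
    simp [ha0, sub_eq_zero, hd0, hda] at this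
  push Not at hb01 hba
  obtain ⟨hb0, hb1⟩ := hb01
  obtain ⟨hb2, hb3⟩ := hba
  have hz : 1 * b * (1 + b) ≠ 0 := by
    refine mul_ne_zero (by simpa using hb0) fun h => hb1 ?_
    linear_combination h - h2
  have heq : 1 * b * (1 + b) = a * d * (a + d) := by
    linear_combination hbd - a * d * (a + d) * h2
  -- two planes with the same nonzero product that share a nonzero element are equal
  have key (e : K) (he : 1 * b * (1 + b) = a * e * (a + e)) :
      e ≠ 1 ∧ e ≠ b ∧ e ≠ 1 + b := by
    refine ⟨?_, ?_, ?_⟩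
    · rintro rfl
      have : (b - a) * (b - (a + 1)) = 0 := by linear_combination he + (a ^ 2 + a - a * b - b) * h2
      simp [sub_eq_zero, hb2, hb3] at this
    · rintro rfl
      have : e * (a - 1) * (e - (a + 1)) = 0 := by
        linear_combination he + (a * e ^ 2 - e ^ 2) * h2
      simp [sub_eq_zero, hb0, hb3, ha1] at this
    · rintro rfl
      have : (b - 1) * (a - 1) * (b - a) = 0 := by
        linear_combination he + ((1 + b) * (a + a ^ 2 + a * b) - a ^ 2 * b - b ^ 2 - a * b - a) * h2
      simp [sub_eq_zero, hb1, hb2, ha1] at this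
  have hd := key d heq
  have had := key (a + d) (by linear_combination heq - a ^ 2 * (a + d) * h2)
  refine ⟨1, b, a, d, hz, heq, ?_⟩
  rintro x hx (rfl | rfl | rfl)
  · rcases hx with h | h | h
    · exact ha1 h
    · exact hb2 h.symm
    · exact hb3 (by linear_combination -h - h2)
  · tauto
  · tauto

end Planes

/-! ### Spans of powers -/

/-- The powers with exponent `2 ^ s - 1` span `𝔽_{2ⁿ}` over `𝔽₂` if `0 < s < n`. Their span `E` is a
subfield, and `x ↦ x ^ 2 ^ s` is additive and maps every `x` into the line `E x`. If `E` were
proper, this would force the map to be the identity. -/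
theorem eq_top_of_pow_mem {K : Type*} [Field K] [Algebra (ZMod 2) K] [Fintype K] {s : ℕ}
    (hs : 0 < s) (hsn : s < Module.finrank (ZMod 2) K) (S : Submodule (ZMod 2) K)
    (hS : ∀ x : K, x ^ (2 ^ s - 1) ∈ S) : S = ⊤ := by
  have : CharP K 2 := charP_of_injective_algebraMap (algebraMap (ZMod 2) K).injective 2
  have hpos : 2 ≤ 2 ^ s := by simpa using Nat.pow_le_pow_right (n := 2) two_pos hs
  have hsucc (x : K) : x ^ (2 ^ s - 1) * x = x ^ 2 ^ s := by
    rw [← pow_succ, Nat.sub_add_cancel (by omega)]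
  let E : Subalgebra (ZMod 2) K :=
    Algebra.adjoin (ZMod 2) (MonoidHom.mrange (powMonoidHom (α := K) (2 ^ s - 1)) : Set K)
  have hpow (x : K) : x ^ (2 ^ s - 1) ∈ E := Algebra.subset_adjoin ⟨x, rfl⟩
  have hES : Subalgebra.toSubmodule E ≤ S := by
    rw [Algebra.adjoin_eq_span, Submonoid.closure_eq, Submodule.span_le]
    rintro _ ⟨x, rfl⟩
    exact hS x
  have hinv {x : K} (hx : x ∈ E) : x⁻¹ ∈ E := by
    by_cases h0 : x = 0
    · rw [h0, inv_zero]; exact E.zero_mem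
    have hq : 1 < Fintype.card K := Fintype.one_lt_card
    rw [inv_eq_of_mul_eq_one_left (b := x) (a := x ^ (Fintype.card K - 2))]
    · exact E.pow_mem hx _
    · rw [← pow_succ, ← FiniteField.pow_card_sub_one_eq_one x h0]
      congr 1
      omega
  by_contra hne
  obtain ⟨m, hm⟩ : ∃ m, m ∉ E := by
    by_contra! h
    exact hne (top_le_iff.mp fun x _ => hES (h x))
  -- the additive map multiplies `1`, `x` and `1 + x` by elements of `E`; these must agree
  have hout {x : K} (hx : x ∉ E) : x ^ (2 ^ s - 1) = 1 := by
    have h1 : (1 + x) ^ (2 ^ s - 1) * (1 + x) = 1 + x ^ (2 ^ s - 1) * x := by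
      rw [hsucc, hsucc, add_pow_char_pow, one_pow]
    have h2 : x * ((1 + x) ^ (2 ^ s - 1) - x ^ (2 ^ s - 1)) = 1 - (1 + x) ^ (2 ^ s - 1) := by
      linear_combination h1
    have h3 : (1 + x) ^ (2 ^ s - 1) - x ^ (2 ^ s - 1) = 0 := by
      by_contra h
      refine hx ?_
      rw [eq_div_of_mul_eq h h2, div_eq_mul_inv]
      exact E.mul_mem (E.sub_mem E.one_mem (hpow _)) (hinv (E.sub_mem (hpow _) (hpow _)))
    rw [h3, mul_zero] at h2
    linear_combination h2 - h3
  have hall (x : Kˣ) : x ^ (2 ^ s - 1) = 1 := by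
    rw [Units.ext_iff, Units.val_pow_eq_pow_val, Units.val_one]
    by_cases hx : (x : K) ∈ E
    · have hxm : (x : K) * m ∉ E := fun h => hm (by
        have := E.mul_mem (hinv hx) h
        rwa [inv_mul_cancel_left₀ x.ne_zero] at this)
      have := hout hxm
      rwa [mul_pow, hout hm, mul_one] at this
    · exact hout hx
  have hdvd := (FiniteField.forall_pow_eq_one_iff K _).mp hall
  have hle := Nat.le_of_dvd (by omega) hdvd
  have hcard := Module.card_eq_pow_finrank (K := ZMod 2) (V := K)
  rw [ZMod.card] at hcard
  have := Nat.pow_lt_pow_right (a := 2) one_lt_two hsn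
  omega

theorem Submodule.exists_le_finrank_eq {F V : Type*} [Field F] [AddCommGroup V] [Module F V]
    [FiniteDimensional F V] (T₀ : Submodule F V) {m : ℕ} (h₀ : Module.finrank F T₀ ≤ m)
    (hm : m ≤ Module.finrank F V) : ∃ T, T₀ ≤ T ∧ Module.finrank F T = m := by
  induction m, h₀ using Nat.le_induction with
  | base => exact ⟨T₀, le_rfl, rfl⟩
  | succ m _ ih =>
    obtain ⟨T, hT, rfl⟩ := ih (by omega)
    obtain ⟨v, hv⟩ : ∃ v, v ∉ T := by
      by_contra! h
      rw [(Submodule.eq_top_iff'.mpr h : T = ⊤), finrank_top] at hm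
      omega
    exact ⟨T ⊔ Submodule.span F {v}, hT.trans le_sup_left, finrank_sup_span_singleton hv⟩

/-! ### Indicators of subspaces -/

section Indicator

variable {n : ℕ} {K : Type*} [Field K] [Algebra (ZMod 2) K] (φ : F2Vec n ≃ₗ[ZMod 2] K)

open Classical in
/-- The indicator of a subspace of `K`, as a word on `𝔽₂ⁿ ≅ K`. -/
noncomputable def indicatorWord (V : Submodule (ZMod 2) K) : F2Word n :=
  fun x => if φ x ∈ V then 1 else 0

theorem finrank_eq_of_equiv_f2Vec (φ : F2Vec n ≃ₗ[ZMod 2] K) : Module.finrank (ZMod 2) K = n := by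
  rw [← φ.finrank_eq]; simp

/-- A subspace of codimension `r` is cut out by `r` linear equations, so its indicator is a product
of `r` polynomials of degree one. -/
theorem indicatorWord_mem_reedMuller {r : ℕ} {V : Submodule (ZMod 2) K}
    (hV : Module.finrank (ZMod 2) V + r = n) : indicatorWord φ V ∈ reedMuller r n := by
  have : FiniteDimensional (ZMod 2) K := φ.finiteDimensional
  have hq : Module.finrank (ZMod 2) (K ⧸ V) = Module.finrank (ZMod 2) (Fin r → ZMod 2) := by
    have := Submodule.finrank_quotient_add_finrank V
    rw [finrank_eq_of_equiv_f2Vec φ] at this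
    rw [Module.finrank_fin_fun]
    omega
  let e : (K ⧸ V) ≃ₗ[ZMod 2] (Fin r → ZMod 2) := LinearEquiv.ofFinrankEq _ _ hq
  let l : F2Vec n →ₗ[ZMod 2] (Fin r → ZMod 2) := e.toLinearMap ∘ₗ V.mkQ ∘ₗ φ.toLinearMap
  have hl (x : F2Vec n) : φ x ∈ V ↔ ∀ i, l x i = 0 := by
    rw [← Submodule.Quotient.mk_eq_zero, ← e.map_eq_zero_iff, funext_iff]
    rfl
  let p : MvPolynomial (Fin n) (ZMod 2) := ∏ i, (1 + ∑ j, MvPolynomial.C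
    (l (fun k => if j = k then 1 else 0) i) * MvPolynomial.X j)
  refine ⟨p, ?_, ?_⟩
  · rw [SetLike.mem_coe, MvPolynomial.mem_restrictTotalDegree]
    refine (MvPolynomial.totalDegree_finsetProd _ _).trans ?_
    refine (Finset.sum_le_card_nsmul _ _ 1 fun i _ => ?_).trans_eq (by simp)
    refine (MvPolynomial.totalDegree_add _ _).trans (max_le (by simp) ?_)
    refine MvPolynomial.totalDegree_finsetSum_le fun j _ => ?_
    exact (MvPolynomial.totalDegree_mul _ _).trans (by simp)
  · funext x
    have hx (i : Fin r) : l x i = ∑ j, l (fun k => if j = k then 1 else 0) i * x j := by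
      conv_lhs => rw [LinearMap.pi_apply_eq_sum_univ l x]
      simp [mul_comm]
    change MvPolynomial.eval x p = _
    simp only [p, map_prod, map_add, map_one, map_sum, map_mul, MvPolynomial.eval_C,
      MvPolynomial.eval_X, ← hx, indicatorWord, hl]
    split_ifs with h
    · simp [h]
    · push Not at h
      obtain ⟨i, hi⟩ := h
      refine Finset.prod_eq_zero (Finset.mem_univ i) ?_
      rcases zmod_two_cases (l x i) with h | h
      · exact absurd h hi
      · rw [h]; rfl

theorem mem_wordSupport_indicatorWord {V : Submodule (ZMod 2) K} {x : F2Vec n} :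
    x ∈ wordSupport (indicatorWord φ V) ↔ φ x ∈ V := by
  simp [mem_wordSupport, indicatorWord]

theorem card_wordSupport_indicatorWord (V : Submodule (ZMod 2) K) :
    (wordSupport (indicatorWord φ V)).card = 2 ^ Module.finrank (ZMod 2) V := by
  classical
  have : Fintype V := Fintype.ofInjective (fun v : V => φ.symm v)
    (φ.symm.injective.comp Subtype.val_injective)
  have h := Module.card_eq_pow_finrank (K := ZMod 2) (V := V)
  rw [ZMod.card] at h
  rw [← h, ← Fintype.card_coe]
  exact Fintype.card_congr (φ.toEquiv.subtypeEquiv fun x => mem_wordSupport_indicatorWord φ)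

/-! ### The syndrome of the power function -/

/-- The value `∑ c(x) x ^ d` in `K` of the parity checks given by the power function. -/
noncomputable def powerSyndrome (d : ℕ) : F2Word n →ₗ[ZMod 2] K :=
  Fintype.linearCombination (ZMod 2) fun x => φ x ^ d

theorem powerSyndrome_apply (d : ℕ) (c : F2Word n) :
    powerSyndrome φ d c = ∑ x, c x • φ x ^ d := rfl

theorem powerSyndrome_eq_sum_wordSupport [DecidableEq K] (d : ℕ) (c : F2Word n) :
    powerSyndrome φ d c = ∑ y ∈ (wordSupport c).image φ, y ^ d := by
  rw [Finset.sum_image φ.injective.injOn, powerSyndrome_apply, wordSupport, Finset.sum_filter]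
  refine Finset.sum_congr rfl fun x _ => ?_
  rcases zmod_two_cases (c x) with h | h <;> simp [h]

theorem powerSyndrome_indicatorWord [Fintype K] {s : ℕ} {V : Submodule (ZMod 2) K}
    (hV : Module.finrank (ZMod 2) V = s) :
    powerSyndrome φ (2 ^ s - 1) (indicatorWord φ V) = ∏ v ∈ nonzeroElements V, v := by
  classical
  rw [← sum_pow_submodule V hV, powerSyndrome_eq_sum_wordSupport]
  refine Finset.sum_congr ?_ fun _ _ => rfl
  ext y
  simp only [Finset.mem_image, mem_wordSupport_indicatorWord, Finset.mem_filter, Finset.mem_univ,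
    true_and]
  exact ⟨by rintro ⟨x, hx, rfl⟩; exact hx, fun hy => ⟨φ.symm y, by simpa using hy, by simp⟩⟩

/-- A word of small weight in the Reed-Muller code is the indicator of a flat, and its syndrome is
nonzero. -/
theorem le_card_wordSupport_of_powerSyndrome_eq_zero {r : ℕ} (hrn : r < n) {c : F2Word n}
    (hc : c ∈ reedMuller r n) (h0 : c ≠ 0) (hsyn : powerSyndrome φ (2 ^ (n - r) - 1) c = 0) :
    3 * 2 ^ (n - r - 1) ≤ (wordSupport c).card := by
  classical
  by_contra! hlt
  have hn : 2 ^ n = 2 * (2 ^ (n - r - 1) * 2 ^ r) := by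
    rw [← pow_add, ← pow_succ']
    congr 1
    omega
  have hR : 0 < 2 ^ r := by positivity
  obtain ⟨hflat, hcard⟩ := (DegreeLT.of_mem_reedMuller hc).isFlat_wordSupport h0 (by
    rw [hn]
    have := Nat.mul_lt_mul_of_pos_right hlt hR
    linarith)
  have hcard' : (wordSupport c).card = 2 ^ (n - r) := by
    refine Nat.eq_of_mul_eq_mul_right hR ?_
    rw [hcard, ← pow_add, Nat.sub_add_cancel hrn.le]
  have himage : IsFlat ((wordSupport c).image φ) := by
    intro x hx y hy z hz
    obtain ⟨x, hx', rfl⟩ := Finset.mem_image.mp hx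
    obtain ⟨y, hy', rfl⟩ := Finset.mem_image.mp hy
    obtain ⟨z, hz', rfl⟩ := Finset.mem_image.mp hz
    rw [← map_add, ← map_add]
    exact Finset.mem_image_of_mem _ (hflat hx' hy' hz')
  rw [powerSyndrome_eq_sum_wordSupport, ← hcard',
    ← Finset.card_image_of_injective _ φ.injective] at hsyn
  exact himage.sum_pow_card_sub_one_ne_zero ((wordSupport_nonempty h0).image _) hsyn

/-- The indicators of the subspaces `x V`, where `V` has dimension `s`, have the syndromes
`x ^ (2 ^ s - 1) * M`, where `M` is the product of the nonzero elements of `V`; these span `K`. -/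
theorem map_powerSyndrome_reedMuller {r : ℕ} (hr : 0 < r) (hrn : r < n) :
    (reedMuller r n).map (powerSyndrome φ (2 ^ (n - r) - 1)) = ⊤ := by
  have : Fintype K := Fintype.ofEquiv _ φ.toEquiv
  have hfin := finrank_eq_of_equiv_f2Vec φ
  obtain ⟨V, -, hV⟩ := Submodule.exists_le_finrank_eq (⊥ : Submodule (ZMod 2) K) (m := n - r)
    (by simp) (by omega)
  set M := ∏ v ∈ nonzeroElements V, v with hM
  have hM0 : M ≠ 0 := Finset.prod_ne_zero_iff.mpr fun v hv => (mem_nonzeroElements.mp hv).2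
  have hd : 2 ^ (n - r) - 1 ≠ 0 := by
    have := Nat.one_lt_two_pow (n := n - r) (by omega)
    omega
  have htop := eq_top_of_pow_mem (s := n - r) (by omega) (by omega)
    (((reedMuller r n).map (powerSyndrome φ (2 ^ (n - r) - 1))).comap
      (LinearMap.mulRight (ZMod 2) M)) (fun x => by
    rw [Submodule.mem_comap, LinearMap.mulRight_apply]
    by_cases hx : x = 0
    · rw [hx, zero_pow hd, zero_mul]
      exact Submodule.zero_mem _
    let ψ : F2Vec n ≃ₗ[ZMod 2] K := φ.trans
      ((LinearEquiv.smulOfNeZero K K x⁻¹ (inv_ne_zero hx)).restrictScalars (ZMod 2))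
    have hψ (y : F2Vec n) : φ y = x * ψ y := (mul_inv_cancel_left₀ hx (φ y)).symm
    refine ⟨indicatorWord ψ V, indicatorWord_mem_reedMuller ψ (by omega), ?_⟩
    rw [hM, ← powerSyndrome_indicatorWord ψ hV, powerSyndrome_apply, powerSyndrome_apply,
      Finset.mul_sum]
    refine Finset.sum_congr rfl fun y _ => ?_
    rw [hψ, mul_pow, mul_smul_comm])
  refine top_le_iff.mp fun y _ => ?_
  have hy : y * M⁻¹ ∈ (⊤ : Submodule (ZMod 2) K) := Submodule.mem_top
  rwa [← htop, Submodule.mem_comap, LinearMap.mulRight_apply, inv_mul_cancel_right₀ hM0] at hy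

/-- There is a word of weight `3 * 2 ^ (n - r - 1)` and syndrome zero, namely the sum of the
indicators of two subspaces of dimension `n - r` that meet in a subspace `U` of dimension
`n - r - 2`. They are the inverse images under `vanishingMap U` of two planes `P` and `P'` that meet
in `0` and whose nonzero elements have the same product, and `U` is chosen so that the range of
this map contains both planes. -/
theorem exists_powerSyndrome_eq_zero {r : ℕ} (hr : 2 ≤ r) (hrn : r + 2 ≤ n) :
    ∃ c ∈ reedMuller r n, powerSyndrome φ (2 ^ (n - r) - 1) c = 0 ∧
      (wordSupport c).card = 3 * 2 ^ (n - r - 1) := by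
  classical
  have : Fintype K := Fintype.ofEquiv _ φ.toEquiv
  have hfin := finrank_eq_of_equiv_f2Vec φ
  obtain ⟨a, b, c, d, hab, heq, hdisj⟩ := exists_planes_prod_eq (K := K) (by omega)
  have hcd : c * d * (c + d) ≠ 0 := heq ▸ hab
  set P := Submodule.span (ZMod 2) {a, b}
  set P' := Submodule.span (ZMod 2) {c, d}
  have hP : Module.finrank (ZMod 2) P = 2 := finrank_span_pair hab
  have hP' : Module.finrank (ZMod 2) P' = 2 := finrank_span_pair hcd
  have hle := Submodule.finrank_add_le_finrank_add_finrank P P'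
  obtain ⟨T, hT, hTr⟩ := Submodule.exists_le_finrank_eq (P ⊔ P') (m := r + 2) (by omega) (by omega)
  obtain ⟨U, _, hU, hUr⟩ := exists_range_vanishingMap_eq T
  have hPU : P ≤ LinearMap.range (vanishingMap U) := hU ▸ le_sup_left.trans hT
  have hPU' : P' ≤ LinearMap.range (vanishingMap U) := hU ▸ le_sup_right.trans hT
  have hV : Module.finrank (ZMod 2) (P.comap (vanishingMap U)) = n - r := by
    rw [finrank_comap_vanishingMap hPU]; omega
  have hV' : Module.finrank (ZMod 2) (P'.comap (vanishingMap U)) = n - r := by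
    rw [finrank_comap_vanishingMap hPU']; omega
  refine ⟨indicatorWord φ (P.comap (vanishingMap U)) + indicatorWord φ (P'.comap (vanishingMap U)),
    Submodule.add_mem _ (indicatorWord_mem_reedMuller φ (by omega))
      (indicatorWord_mem_reedMuller φ (by omega)), ?_, ?_⟩
  · rw [map_add, powerSyndrome_indicatorWord φ hV, powerSyndrome_indicatorWord φ hV',
      prod_nonzeroElements_comap hPU, prod_nonzeroElements_comap hPU',
      prod_nonzeroElements_span_pair hab, prod_nonzeroElements_span_pair hcd, heq,
      ZModModule.add_self]
  · have hinter : wordSupport (indicatorWord φ (P.comap (vanishingMap U))) ∩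
        wordSupport (indicatorWord φ (P'.comap (vanishingMap U))) =
        wordSupport (indicatorWord φ U) := by
      ext x
      simp only [Finset.mem_inter, mem_wordSupport_indicatorWord, Submodule.mem_comap]
      have hx : φ x ∈ U ↔ vanishingMap U (φ x) = 0 := by rw [← LinearMap.mem_ker, ker_vanishingMap]
      rw [hx]
      refine ⟨fun h => ?_, fun h => by simp [h]⟩
      by_contra h0
      have h1 := mem_nonzeroElements.mpr ⟨h.1, h0⟩
      have h2 := mem_nonzeroElements.mpr ⟨h.2, h0⟩
      rw [nonzeroElements_span_pair hab] at h1
      rw [nonzeroElements_span_pair hcd] at h2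
      simp only [Finset.mem_insert, Finset.mem_singleton] at h1 h2
      exact hdisj _ h1 h2
    have h := card_symmDiff_add (wordSupport (indicatorWord φ (P.comap (vanishingMap U))))
      (wordSupport (indicatorWord φ (P'.comap (vanishingMap U))))
    rw [hinter, ← wordSupport_add, card_wordSupport_indicatorWord, card_wordSupport_indicatorWord,
      card_wordSupport_indicatorWord, hV, hV', show Module.finrank (ZMod 2) U = n - r - 2 by omega,
      show n - r = n - r - 2 + 2 by omega] at h
    rw [show n - r - 1 = n - r - 2 + 1 by omega]
    rw [show n - r - 2 + 2 - 2 = n - r - 2 by omega] at h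
    rw [pow_succ]
    rw [pow_add] at h
    omega

end Indicator

/-! ### The subcode of the power function -/

theorem subcodeOfFunction_powerFunction_eq {r n d : ℕ} {K : Type*} [Field K] [Algebra (ZMod 2) K]
    (φ : F2Vec n ≃ₗ[ZMod 2] K) {ι : Type*} {H : Matrix ι (F2Vec n) (ZMod 2)}
    (hH : codeOfParityCheck H = reedMuller r n) :
    subcodeOfFunction H (powerFunction φ d) =
      reedMuller r n ⊓ LinearMap.ker (powerSyndrome φ d) := by
  ext c
  have hval : (valueMatrix (powerFunction φ d)).mulVec c = φ.symm (powerSyndrome φ d c) := by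
    funext i
    rw [powerSyndrome_apply, map_sum, Finset.sum_apply]
    refine Finset.sum_congr rfl fun x _ => ?_
    rw [map_smul, Pi.smul_apply, smul_eq_mul, mul_comm]
    rfl
  rw [← hH, Submodule.mem_inf, subcodeOfFunction, codeOfParityCheck, codeOfParityCheck,
    LinearMap.mem_ker, LinearMap.mem_ker, LinearMap.mem_ker, Matrix.mulVecLin_apply,
    Matrix.mulVecLin_apply, Matrix.fromRows_mulVec, hval, ← φ.symm.map_eq_zero_iff (x := _)]
  constructor
  · intro h
    exact ⟨funext fun i => congrFun h (Sum.inl i), funext fun i => congrFun h (Sum.inr i)⟩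
  · rintro ⟨h1, h2⟩
    rw [h1, h2]
    exact Sum.elim_zero_zero

theorem hammingNorm_eq_card_wordSupport {n : ℕ} (c : F2Word n) :
    hammingNorm c = (wordSupport c).card := by
  rw [hammingNorm, wordSupport]

theorem corollary4p6 (r n : ℕ) (hr : 2 ≤ r) (hrn : r ≤ n - 2)
    {K : Type*} [Field K] [Algebra (ZMod 2) K] (φ : F2Vec n ≃ₗ[ZMod 2] K)
    {ι : Type*} (H : Matrix ι (F2Vec n) (ZMod 2)) (hH : codeOfParityCheck H = reedMuller r n) :
    subcodeOfFunction H (powerFunction φ (2 ^ (n - r) - 1)) ≤ reedMuller r n ∧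
    Module.finrank (ZMod 2) (subcodeOfFunction H (powerFunction φ (2 ^ (n - r) - 1))) + n =
      Module.finrank (ZMod 2) (reedMuller r n) ∧
    HasMinDistance (subcodeOfFunction H (powerFunction φ (2 ^ (n - r) - 1)))
      (3 * 2 ^ (n - r - 1)) ∧
    ∀ c : F2Word n, IsMinWeightCodeword (reedMuller r n) c →
      c ∉ subcodeOfFunction H (powerFunction φ (2 ^ (n - r) - 1)) := by
  rw [subcodeOfFunction_powerFunction_eq φ hH]
  have hpos : 0 < 2 ^ (n - r - 1) := by positivity
  have hfin := finrank_eq_of_equiv_f2Vec φ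
  have : FiniteDimensional (ZMod 2) K := φ.finiteDimensional
  refine ⟨inf_le_left, ?_, ⟨?_, ?_⟩, ?_⟩
  · let g := (powerSyndrome φ (2 ^ (n - r) - 1)).domRestrict (reedMuller r n)
    have hrange : LinearMap.range g = ⊤ := by
      rw [LinearMap.range_domRestrict]
      exact map_powerSyndrome_reedMuller φ (by omega) (by omega)
    have hker : (LinearMap.ker g).map (reedMuller r n).subtype =
        reedMuller r n ⊓ LinearMap.ker (powerSyndrome φ (2 ^ (n - r) - 1)) := by
      rw [← Submodule.map_comap_subtype]
      rfl
    have h := LinearMap.finrank_range_add_finrank_ker g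
    rw [hrange, finrank_top, hfin, ← Submodule.finrank_map_subtype_eq, hker] at h
    omega
  · obtain ⟨c, hc, hsyn, hcard⟩ := exists_powerSyndrome_eq_zero φ hr (by omega : r + 2 ≤ n)
    refine ⟨c, ⟨hc, hsyn⟩, 0, Submodule.zero_mem _, ?_, ?_⟩
    · rintro rfl
      rw [wordSupport_zero, Finset.card_empty] at hcard
      omega
    · rw [hammingDist_zero_right, hammingNorm_eq_card_wordSupport, hcard]
  · rintro k ⟨c, hc, c', hc', hne, rfl⟩
    have h := Submodule.sub_mem _ hc' hc
    rw [hammingDist_eq_hammingNorm, neg_add_eq_sub, hammingNorm_eq_card_wordSupport]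
    exact le_card_wordSupport_of_powerSyndrome_eq_zero φ (by omega) h.1
      (sub_ne_zero.mpr hne.symm) h.2
  · rintro c ⟨hc, h0, hmin⟩ hmem
    have hle := le_card_wordSupport_of_powerSyndrome_eq_zero φ (by omega) hc h0 hmem.2
    obtain ⟨V, -, hV⟩ := Submodule.exists_le_finrank_eq (⊥ : Submodule (ZMod 2) K) (m := n - r)
      (by simp) (by omega)
    have hcard := card_wordSupport_indicatorWord φ V
    have := hmin (indicatorWord φ V) (indicatorWord_mem_reedMuller φ (by omega)) fun h => by
      rw [h, wordSupport_zero, Finset.card_empty] at hcard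
      exact absurd hcard.symm (by positivity)
    rw [hammingNorm_eq_card_wordSupport, hammingNorm_eq_card_wordSupport, hcard, hV,
      show n - r = n - r - 1 + 1 by omega, pow_succ] at this
    omega
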